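/- Let $N\ge 2$ and $D\ge 0$ be integers. Let $\mathfrak A=(\bigotimes^{N-1}\bigwedge \mathbb R^{D*})\otimes C^\infty(\mathbb R^D)$ be the algebra of multiforms, where $\bigotimes^{N-1}$ is the graded tensor product of $N-1$ copies of the exterior algebra of the dual space of $\mathbb R^D$; that is, $\mathfrak A$ is generated over $C^\infty(\mathbb R^D)$ by the $(N-1)D$ anticommuting elements $d_ix^\mu$ ($1\le i\le N-1$, $1\le \mu\le D$). For $1\le i\le N-1$ let $d_i$ be the antiderivation of $\mathfrak A$ with $d_if=\sum_\mu \partial_\mu f\, d_ix^\mu$ for $f\in C^\infty(\mathbb R^D)$ and $d_i(d_jx^\mu)=0$ for all $j,\mu$; these antiderivations anticommute. For $J\subset\{1,\dots,N-1\}$ let $\prod_{j\in J}d_j$ denote the composition in increasing order of the indices (the identity if $J=\emptyset$). Let $K$ be a non-empty subset of $\{1,\dots,N-1\}$, let $m$ be an integer with $0\le m\le \#K$, and let $\omega\in\mathfrak A$ be such that $$\Big(\prod_{i\in I}d_i\Big)\omega=0\qquad\text{for all } I\subset K \text{ with } \#I=m .$$ Then there are multiforms $\alpha_J\in\mathfrak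 A$ and $\omega_0\in\mathfrak A$ with $$\omega=\sum_{\substack{J\subset K\\ \#J=\#K-m+1}}\Big(\prod_{j\in J}d_j\Big)\alpha_J+\omega_0 ,$$ where $\omega_0$ is a polynomial multiform of degree $\le m-1$, i.e. its coefficients with respect to the monomials in the $d_ix^\mu$ are polynomial functions on $\mathbb R^D$ of degree $\le m-1$ (so $\omega_0=0$ if $m=0$). -/

import Mathlib

namespace Multicomplex

open scoped Manifold ContDiff TensorProduct

noncomputable section

/-- The space `ℝ^D`. -/
abbrev Space (D : ℕ) : Type := EuclideanSpace ℝ (Fin D)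

/-- The algebra `C^∞(ℝ^D)` of real smooth functions on `ℝ^D`. -/
abbrev Smooth (D : ℕ) : Type := C^∞⟮𝓘(ℝ, Space D), Space D; 𝓘(ℝ, ℝ), ℝ⟯

/-- The partial derivative `∂_μ : C^∞(ℝ^D) → C^∞(ℝ^D)`. -/
def partialDeriv {D : ℕ} (μ : Fin D) : Smooth D →ₗ[ℝ] Smooth D where
  toFun f := ⟨fun x => fderiv ℝ f x (EuclideanSpace.single μ 1),
    (((f.contMDiff.contDiff).fderiv_right (m := ∞) (by simp)).clm_apply
      contDiff_const).contMDiff⟩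
  map_add' f g := by
    ext x
    have hf : DifferentiableAt ℝ f x := (f.contMDiff.contDiff.differentiable (by simp)) x
    have hg : DifferentiableAt ℝ g x := (g.contMDiff.contDiff.differentiable (by simp)) x
    change fderiv ℝ (⇑f + ⇑g) x _ = fderiv ℝ f x _ + fderiv ℝ g x _
    rw [fderiv_add hf hg]
    rfl
  map_smul' c f := by
    ext x
    have hf : DifferentiableAt ℝ f x := (f.contMDiff.contDiff.differentiable (by simp)) x
    change fderiv ℝ (c • ⇑f) x _ = c • fderiv ℝ f x _
    rw [fderiv_const_smul hf]
    rfl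

/-- The graded tensor product of `n` copies of the exterior algebra `⋀ ℝ^{D*}`, realised as the
exterior algebra of the direct sum of `n` copies of the dual space `ℝ^{D*}` (elements of
different copies anticommute). -/
abbrev ConstForms (n D : ℕ) : Type :=
  ExteriorAlgebra ℝ (Fin n → Module.Dual ℝ (Space D))

/-- The generator `d_i x^μ`: the coordinate form `x^μ`, placed in the `i`-th copy of `ℝ^{D*}`. -/
def dx {n D : ℕ} (i : Fin n) (μ : Fin D) : ConstForms n D :=
  ExteriorAlgebra.ι ℝ
    (Pi.single i ((EuclideanSpace.proj μ : Space D →L[ℝ] ℝ) : Module.Dual ℝ (Space D)))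

/-- The algebra `𝔄` of multiforms, `(⨂ⁿ ⋀ ℝ^{D*}) ⊗ C^∞(ℝ^D)`. -/
abbrev Multiform (n D : ℕ) : Type := ConstForms n D ⊗[ℝ] Smooth D

/-- The exterior differential `d_i`, given on `a ⊗ f` by `∑_μ (d_i x^μ · a) ⊗ ∂_μ f`; this is the
antiderivation with `d_i f = ∑_μ ∂_μ f d_i x^μ` and `d_i (d_j x^μ) = 0`. -/
def d {n D : ℕ} (i : Fin n) : Module.End ℝ (Multiform n D) :=
  ∑ μ : Fin D, TensorProduct.map (LinearMap.mulLeft ℝ (dx i μ)) (partialDeriv μ)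

/-- The product `∏_{j ∈ J} d_j`, composed in increasing order of the indices (the order only
affects an overall sign). -/
def dProd {n D : ℕ} (J : Finset (Fin n)) : Module.End ℝ (Multiform n D) :=
  ((J.sort (· ≤ ·)).map d).prod

/-- `f` is a polynomial function all of whose monomials have total degree `< m`; for `m = 0`
this means `f = 0`. -/
def IsPolynomialLT {D : ℕ} (m : ℕ) (f : Smooth D) : Prop :=
  ∃ p : MvPolynomial (Fin D) ℝ, (∀ s ∈ p.support, s.degree < m) ∧
    ∀ x : Space D, f x = MvPolynomial.eval (fun μ => x μ) p

/-- The space of polynomial multiforms of degree `< m`: the multiforms whose coefficients are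
polynomial functions of degree `< m`. -/
def polynomialMultiforms (n D m : ℕ) : Submodule ℝ (Multiform n D) :=
  Submodule.span ℝ {η | ∃ (a : ConstForms n D) (f : Smooth D), IsPolynomialLT m f ∧ η = a ⊗ₜ f}

end

end Multicomplex

/-! Taylor's formula splits ω into a part with polynomial coefficients of degree < m and a part `η`
whose coefficients vanish to order m at the origin (`mem_coeffIn_polynomialsLT_sup`). Products of m
differentials kill the first part, so `η` inherits the hypothesis, and it remains to write `η` as a
sum of `dProd J` terms with no polynomial remainder.

Filter the multiforms by order of vanishing, `M s`. Each `d i` lowers the order by one and is exact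
on `M (s + 1)`, with a potential in `M (s + 2)`: the only obstruction is the value of the
coefficients at the origin (`mem_map_d_of_d_eq_zero`). These facts, anticommutation and truncation
by degree in one copy are all that is used of multiforms, and `ExactMulticomplex` records them.

The core is `exact_modulo`: `d j` stays exact modulo the images of other differentials, provided the
order of vanishing exceeds their number. It is a descent along a double complex, by induction on the
set of differentials and then on the degree in one copy. `mem_of_orderedProd_mem` then removes the
indices of `K` one at a time, moving each into the set `S` of differentials whose images are
ignored; `S = ∅` is the required case. -/

namespace Multicomplex

/-! ### Abstract anticommuting differentials -/

section Abstract

variable {ι V : Type*} [AddCommGroup V] [Module ℝ V]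

lemma eq_zero_of_eq_neg {x : V} (h : x = -x) : x = 0 := by
  have h2 : (2 : ℝ) • x = 0 := by
    rw [two_smul]
    nth_rewrite 1 [h]
    exact neg_add_cancel x
  exact (smul_eq_zero.mp h2).resolve_left two_ne_zero

/-- A family of anticommuting differentials, exact on the positive part of a graded family of
submodules, together with operators `P i p` which truncate to degrees `< p` for the `i`-th
differential. -/
structure ExactMulticomplex (d : ι → Module.End ℝ V) (M : ℕ → Submodule ℝ V)
    (P : ι → ℕ → Module.End ℝ V) : Prop where
  anticomm : ∀ i j ω, d i (d j ω) = -d j (d i ω)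
  d_mem : ∀ i s ω, ω ∈ M (s + 1) → d i ω ∈ M s
  exact : ∀ j s ω, ω ∈ M (s + 1) → d j ω = 0 → ω ∈ (M (s + 2)).map (d j)
  trunc_mem : ∀ i p s ω, ω ∈ M s → P i p ω ∈ M s
  trunc_zero : ∀ i ω, P i 0 ω = 0
  trunc_comm : ∀ i j p ω, i ≠ j → P i p (d j ω) = d j (P i p ω)
  trunc_self : ∀ i p ω, P i (p + 1) (d i ω) = d i (P i p ω)
  trunc_eq : ∀ i ω, ∃ p, P i p ω = ω

/-- The sum of the images of `M t` under the differentials indexed by `S`. -/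
def boundaries (d : ι → Module.End ℝ V) (M : ℕ → Submodule ℝ V) (S : Finset ι) (t : ℕ) :
    Submodule ℝ V :=
  ⨆ i ∈ S, (M t).map (d i)

/-- The product of the `d j`, `j ∈ J`, in increasing order of the indices. -/
def orderedProd [LinearOrder ι] (d : ι → Module.End ℝ V) (J : Finset ι) : Module.End ℝ V :=
  ((J.sort (· ≤ ·)).map d).prod

variable {d : ι → Module.End ℝ V} {M : ℕ → Submodule ℝ V} {P : ι → ℕ → Module.End ℝ V}

lemma boundaries_empty (t : ℕ) : boundaries d M ∅ t = ⊥ := by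
  simp [boundaries]

lemma boundaries_insert [DecidableEq ι] (a : ι) (S : Finset ι) (t : ℕ) :
    boundaries d M (insert a S) t = (M t).map (d a) ⊔ boundaries d M S t :=
  Finset.iSup_insert a S _

lemma boundaries_mono {S T : Finset ι} (h : S ⊆ T) (t : ℕ) :
    boundaries d M S t ≤ boundaries d M T t :=
  biSup_mono fun _ hi => h hi

lemma d_mem_boundaries {i : ι} {S : Finset ι} (hi : i ∈ S) {t : ℕ} {ω : V} (hω : ω ∈ M t) :
    d i ω ∈ boundaries d M S t :=
  Submodule.mem_iSup_of_mem i (Submodule.mem_iSup_of_mem hi (Submodule.mem_map_of_mem hω))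

lemma boundaries_induction {S : Finset ι} {t : ℕ} (T : V →ₗ[ℝ] V) (W : Submodule ℝ V)
    (h : ∀ i ∈ S, ∀ ω ∈ M t, T (d i ω) ∈ W) {ω : V} (hω : ω ∈ boundaries d M S t) :
    T ω ∈ W := by
  have : boundaries d M S t ≤ W.comap T := by
    refine iSup₂_le fun i hi => ?_
    rintro _ ⟨ω, hω, rfl⟩
    exact h i hi ω hω
  exact this hω

lemma orderedProd_empty [LinearOrder ι] : orderedProd d ∅ = 1 := by simp [orderedProd]

lemma orderedProd_insert [LinearOrder ι] {a : ι} {J : Finset ι} (h : ∀ b ∈ J, a < b) (ω : V) :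
    orderedProd d (insert a J) ω = d a (orderedProd d J ω) := by
  have ha : a ∉ J := fun hh => lt_irrefl _ (h a hh)
  rw [orderedProd, Finset.sort_insert (r := (· ≤ ·)) (fun b hb => (h b hb).le) ha]
  simp [orderedProd]

/-- Only the lowering property of `M` is needed, so this also serves for the filtrations by
`boundaries` and by polynomial degree. -/
lemma orderedProd_mem [LinearOrder ι] (h : ∀ i s ω, ω ∈ M (s + 1) → d i ω ∈ M s)
    (I : Finset ι) {s : ℕ} {ω : V} (hω : ω ∈ M (s + I.card)) : orderedProd d I ω ∈ M s := by
  have key : ∀ (l : List ι) (s : ℕ), ω ∈ M (s + l.length) → (l.map d).prod ω ∈ M s := by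
    intro l
    induction l with
    | nil => intro s h; simpa using h
    | cons a l ih =>
      intro s hs
      simp only [List.map_cons, List.prod_cons, Module.End.mul_apply]
      exact h a s _ (ih (s + 1) (by rwa [List.length_cons, ← add_assoc, add_right_comm] at hs))
  exact key _ _ (by rwa [Finset.length_sort])

namespace ExactMulticomplex

lemma d_d (H : ExactMulticomplex d M P) (i : ι) (ω : V) : d i (d i ω) = 0 :=
  eq_zero_of_eq_neg (H.anticomm i i ω)

lemma d_boundaries (H : ExactMulticomplex d M P) (j : ι) {S : Finset ι} {t : ℕ} {ω : V}
    (hω : ω ∈ boundaries d M S (t + 1)) : d j ω ∈ boundaries d M S t := by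
  refine boundaries_induction (d j) _ (fun i hi η hη => ?_) hω
  rw [H.anticomm]
  exact neg_mem (d_mem_boundaries hi (H.d_mem j t η hη))

lemma trunc_boundaries (H : ExactMulticomplex d M P) {a : ι} (p : ℕ) {S : Finset ι}
    (ha : a ∉ S) {t : ℕ} {ω : V} (hω : ω ∈ boundaries d M S t) :
    P a p ω ∈ boundaries d M S t := by
  refine boundaries_induction (P a p) _ (fun i hi η hη => ?_) hω
  rw [H.trunc_comm a i p η (fun h => ha (h ▸ hi))]
  exact d_mem_boundaries hi (H.trunc_mem a p t η hη)

/-- Exactness of `d j` modulo the images of the other differentials. -/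
theorem exact_modulo [DecidableEq ι] (H : ExactMulticomplex d M P) (S : Finset ι) :
    ∀ j ∉ S, ∀ s ≥ S.card, ∀ ω ∈ M (s + 1), d j ω ∈ boundaries d M S (s + 1) →
      ω ∈ boundaries d M (insert j S) (s + 2) := by
  induction S using Finset.induction_on with
  | empty =>
    intro j _ s _ ω hω h
    rw [boundaries_empty, Submodule.mem_bot] at h
    rw [boundaries_insert]
    exact Submodule.mem_sup_left (H.exact j s ω hω h)
  | insert a T ha ih =>
    intro j hj s hs ω hω h
    rw [Finset.card_insert_of_notMem ha] at hs
    -- The set contains `a`, so there is an order of vanishing to spare; it is spent below on `d j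
    -- α`, which vanishes to one order less than `α`.
    obtain ⟨s, rfl⟩ : ∃ s', s = s' + 1 := ⟨s - 1, by omega⟩
    have hja : a ≠ j := fun h => hj (h ▸ Finset.mem_insert_self a T)
    have hjT : j ∉ T := fun h => hj (Finset.mem_insert_of_mem h)
    -- Descent on the degree in copy `a`. The form ω is quantified inside because the hypothesis is
    -- applied to `α`, where `d j ω = d a α + τ`: truncating ω below `p + 1` involves `α` only below
    -- `p`.
    have key : ∀ p, ∀ ω ∈ M (s + 1 + 1), d j ω ∈ boundaries d M (insert a T) (s + 1 + 1) →
        P a p ω ∈ boundaries d M (insert j (insert a T)) (s + 1 + 2) := by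
      intro p
      induction p with
      | zero =>
        intro ω _ _
        rw [H.trunc_zero]
        exact zero_mem _
      | succ p ihp =>
        intro ω hω h
        have h0 := h
        rw [boundaries_insert, Submodule.mem_sup] at h
        obtain ⟨_, ⟨α, hα, rfl⟩, τ, hτ, e⟩ := h
        -- Applying `d j` to `d j ω = d a α + τ` shows that `d j α` is `d a`-closed modulo `T`;
        -- exactness of `d a` modulo `T` then gives `α` the same hypothesis as ω.
        have h1 : d a (d j α) ∈ boundaries d M T (s + 1) := by
          have : d a (d j α) = d j τ := by
            rw [H.anticomm, ← sub_eq_iff_eq_add.mpr e.symm, map_sub, H.d_d]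
            simp
          rw [this]
          exact H.d_boundaries j hτ
        have h2 := ih a ha s (by omega) _ (H.d_mem j _ α hα) h1
        have h3 := ihp α hα h2
        rw [boundaries_insert, boundaries_insert, Submodule.mem_sup] at h3
        obtain ⟨_, ⟨γ, hγ, rfl⟩, _, h4, e3⟩ := h3
        rw [Submodule.mem_sup] at h4
        obtain ⟨_, ⟨β, hβ, rfl⟩, τ', hτ', rfl⟩ := h4
        -- With `P a p α = d j γ + d a β + τ'`, the correction `d a γ` cancels the term `d a (d j
        -- γ)` and the `β` term dies, so no image of `d a` outside `boundaries d M T` is left.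
        have h5 : d j (P a (p + 1) ω + d a γ) ∈ boundaries d M T (s + 1 + 1) := by
          have : d j (P a (p + 1) ω + d a γ) = d a τ' + P a (p + 1) τ := by
            rw [map_add, ← H.trunc_comm _ _ _ _ hja, ← e, map_add, H.trunc_self, ← e3,
              map_add, map_add, H.d_d, H.anticomm a j]
            abel
          rw [this]
          exact add_mem (H.d_boundaries a hτ') (H.trunc_boundaries _ ha hτ)
        have h6 := ih j hjT (s + 1) (by omega) _
          (add_mem (H.trunc_mem a (p + 1) _ ω hω) (H.d_mem a _ γ hγ)) h5
        have h7 : d a γ ∈ boundaries d M (insert j (insert a T)) (s + 1 + 2) :=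
          d_mem_boundaries (by simp) hγ
        have h8 := boundaries_mono (d := d) (M := M)
          (Finset.insert_subset_insert j (Finset.subset_insert a T)) (s + 1 + 2) h6
        simpa using sub_mem h8 h7
    obtain ⟨p, hp⟩ := H.trunc_eq a ω
    exact hp ▸ key p ω hω h

lemma d_list_prod (H : ExactMulticomplex d M P) (i : ι) (l : List ι) (ω : V) :
    d i ((l.map d).prod ω) = (-1 : ℝ) ^ l.length • (l.map d).prod (d i ω) := by
  induction l with
  | nil => simp
  | cons a l ih =>
    simp only [List.map_cons, List.prod_cons, Module.End.mul_apply, List.length_cons]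
    rw [H.anticomm, ih, map_smul, pow_succ]
    simp

lemma d_list_prod_eq_zero (H : ExactMulticomplex d M P) {i : ι} {l : List ι} (h : i ∈ l)
    (ω : V) : d i ((l.map d).prod ω) = 0 := by
  induction l with
  | nil => simp at h
  | cons a l ih =>
    simp only [List.map_cons, List.prod_cons, Module.End.mul_apply]
    rcases List.mem_cons.mp h with rfl | h
    · exact H.d_d _ _
    · rw [H.anticomm, ih h, map_zero, neg_zero]

lemma list_prod_eq_zero (H : ExactMulticomplex d M P) {i : ι} {l : List ι} (h : i ∈ l)
    {ω : V} (hω : d i ω = 0) : (l.map d).prod ω = 0 := by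
  induction l with
  | nil => simp at h
  | cons a l ih =>
    simp only [List.map_cons, List.prod_cons, Module.End.mul_apply]
    rcases List.mem_cons.mp h with rfl | h
    · rw [H.d_list_prod, hω, map_zero, smul_zero]
    · rw [ih h, map_zero]

/-- By counting, `I` and `J` share an index, and anticommutation brings its two occurrences
together. -/
lemma orderedProd_orderedProd_eq_zero [LinearOrder ι] (H : ExactMulticomplex d M P) {I J K : Finset ι}
    (hI : I ⊆ K) (hJ : J ⊆ K) (h : K.card < I.card + J.card) (ω : V) :
    orderedProd d I (orderedProd d J ω) = 0 := by
  obtain ⟨i, hi⟩ := Finset.inter_nonempty_of_card_lt_card_add_card hI hJ h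
  rw [Finset.mem_inter] at hi
  exact H.list_prod_eq_zero ((Finset.mem_sort _).mpr hi.1)
    (H.d_list_prod_eq_zero ((Finset.mem_sort _).mpr hi.2) ω)

/-- Relative form of the generalized Poincaré lemma, modulo the images of the differentials
indexed by `S`. -/
theorem mem_of_orderedProd_mem [LinearOrder ι] (H : ExactMulticomplex d M P) (K : Finset ι) :
    ∀ (S : Finset ι) (m p t : ℕ) (ω : V), Disjoint S K → m + p = K.card + 1 →
      ω ∈ M (m + S.card + t) →
      (∀ I ⊆ K, I.card = m → orderedProd d I ω ∈ boundaries d M S (S.card + t + 1)) →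
      ω ∈ boundaries d M S (m + S.card + t + 1) ⊔
        ⨆ J ∈ K.powersetCard p, LinearMap.range (orderedProd d J) := by
  -- Removing the least index `a` makes `d a` the outermost factor of `orderedProd d (insert a J)`,
  -- so no signs arise.
  induction K using Finset.induction_on_min with
  | empty =>
    intro S m p t ω _ hmp _ h
    rcases m with _ | m
    · have := h ∅ le_rfl rfl
      rw [orderedProd_empty] at this
      exact Submodule.mem_sup_left (by simpa using this)
    · obtain rfl : p = 0 := by simp at hmp; omega
      refine Submodule.mem_sup_right (Submodule.mem_iSup_of_mem ∅ ?_)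
      refine Submodule.mem_iSup_of_mem (by simp) ⟨ω, by simp [orderedProd_empty]⟩
  | insert a K hlt ih =>
    intro S m p t ω hSK hmp hω h
    have haK : a ∉ K := fun hh => lt_irrefl _ (hlt a hh)
    rw [Finset.disjoint_insert_right] at hSK
    obtain ⟨haS, hSK⟩ := hSK
    have hdis : Disjoint (insert a S) K := Finset.disjoint_insert_left.mpr ⟨haK, hSK⟩
    have hc : (insert a S).card = S.card + 1 := Finset.card_insert_of_notMem haS
    rw [Finset.card_insert_of_notMem haK] at hmp
    rcases m with _ | m
    · have := h ∅ (Finset.empty_subset _) rfl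
      rw [orderedProd_empty] at this
      exact Submodule.mem_sup_left (by simpa using this)
    -- For `p = 0` the summand `J = ∅` is the range of the identity.
    rcases p with _ | p
    · refine Submodule.mem_sup_right (Submodule.mem_iSup_of_mem ∅ ?_)
      refine Submodule.mem_iSup_of_mem (by simp) ⟨ω, by simp [orderedProd_empty]⟩
    have hlt' : ∀ I ⊆ K, ∀ b ∈ I, a < b := fun I hI b hb => hlt b (hI hb)
    have hmem : ∀ I ⊆ K, insert a I ⊆ insert a K := fun I hI => Finset.insert_subset_insert a hI
    have hci : ∀ I ⊆ K, (insert a I).card = I.card + 1 := fun I hI =>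
      Finset.card_insert_of_notMem fun hh => haK (hI hh)
    -- For the sets `I` containing `a`, exactness of `d a` modulo `S` strips off the factor `d a`,
    -- at the price of adding `a` to `S`.
    have h1 := ih (insert a S) m (p + 1) t ω hdis (by omega)
      (by rw [hc]; convert hω using 2; ring) (by
        intro I hI hIm
        have e := h (insert a I) (hmem I hI) (by rw [hci I hI, hIm])
        rw [orderedProd_insert (hlt' I hI)] at e
        rw [hc]
        have := H.exact_modulo S a haS (S.card + t) (by omega) _
          (orderedProd_mem H.d_mem I (s := S.card + t + 1) (by
            rw [hIm]; convert hω using 2; ring)) e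
        convert this using 2; ring)
    rw [boundaries_insert, sup_assoc, Submodule.mem_sup] at h1
    obtain ⟨_, ⟨β, hβ, rfl⟩, _, h2, e1⟩ := h1
    rw [SetLike.mem_coe] at hβ
    rw [Submodule.mem_sup] at h2
    obtain ⟨τ, hτ, σ, hσ, rfl⟩ := h2
    have hs : m + (insert a S).card + t + 1 = m + 1 + S.card + t + 1 := by rw [hc]; ring
    -- The unwanted term `d a β` is treated using the sets `I` that avoid `a`. It suffices to know
    -- `β` up to `p` factors, since the outer `d a` supplies the missing one and kills the component
    -- of `β` in the image of `d a`.
    have h3 := ih (insert a S) (m + 1) p t β hdis (by omega)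
      (by rw [hc]; rw [hs] at hβ; convert hβ using 2; ring) (by
        intro I hI hIm
        have hσ0 : orderedProd d I σ = 0 := by
          have : (⨆ J ∈ K.powersetCard (p + 1), LinearMap.range (orderedProd d J)) ≤
              LinearMap.ker (orderedProd d I) := by
            refine iSup₂_le fun J hJ => ?_
            rw [Finset.mem_powersetCard] at hJ
            rintro _ ⟨η, rfl⟩
            exact H.orderedProd_orderedProd_eq_zero hI hJ.1 (by omega) η
          exact this hσ
        have e : d a (orderedProd d I β) ∈ boundaries d M S (S.card + t + 1) := by
          rw [orderedProd, H.d_list_prod]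
          refine Submodule.smul_mem _ _ ?_
          have : d a β = ω - τ - σ := by rw [← e1]; abel
          change orderedProd d I _ ∈ _
          rw [this, map_sub, map_sub, hσ0, sub_zero]
          refine sub_mem (h I (hI.trans (Finset.subset_insert a K)) hIm)
            (orderedProd_mem (M := boundaries d M S)
              (fun j _ _ => H.d_boundaries j) I ?_)
          rw [hIm]
          convert hτ using 2
          rw [hc]; ring
        rw [hc]
        have := H.exact_modulo S a haS (S.card + t) (by omega) _
          (orderedProd_mem H.d_mem I (s := S.card + t + 1) (by
            rw [hIm]; convert hβ using 2; rw [hc]; ring)) e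
        convert this using 2; ring)
    rw [boundaries_insert, sup_assoc, Submodule.mem_sup] at h3
    obtain ⟨_, ⟨γ, -, rfl⟩, _, h4, e3⟩ := h3
    rw [Submodule.mem_sup] at h4
    obtain ⟨τ', hτ', σ', hσ', rfl⟩ := h4
    have hβ' : d a β = d a τ' + d a σ' := by
      rw [← e3, map_add, map_add, H.d_d, zero_add]
    rw [hs] at hτ
    rw [← e1, hβ']
    have t1 : d a τ' ∈ boundaries d M S (m + 1 + S.card + t + 1) := by
      apply H.d_boundaries
      convert hτ' using 2
      rw [hc]; ring
    have t2 : d a σ' ∈ ⨆ J ∈ (insert a K).powersetCard (p + 1),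
        LinearMap.range (orderedProd d J) := by
      have : (⨆ J ∈ K.powersetCard p, LinearMap.range (orderedProd d J)) ≤
          (⨆ J ∈ (insert a K).powersetCard (p + 1),
            LinearMap.range (orderedProd d J)).comap (d a) := by
        refine iSup₂_le fun J hJ => ?_
        rw [Finset.mem_powersetCard] at hJ
        rintro _ ⟨η, rfl⟩
        refine Submodule.mem_iSup_of_mem (insert a J) (Submodule.mem_iSup_of_mem ?_ ⟨η, ?_⟩)
        · exact Finset.mem_powersetCard.mpr ⟨hmem J hJ.1, by rw [hci J hJ.1, hJ.2]⟩
        · exact orderedProd_insert (hlt' J hJ.1) η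
      exact this hσ'
    have t3 : σ ∈ ⨆ J ∈ (insert a K).powersetCard (p + 1),
        LinearMap.range (orderedProd d J) := by
      have : (⨆ J ∈ K.powersetCard (p + 1), LinearMap.range (orderedProd d J)) ≤
          ⨆ J ∈ (insert a K).powersetCard (p + 1), LinearMap.range (orderedProd d J) :=
        biSup_mono fun J hJ => Finset.powersetCard_mono (Finset.subset_insert a K) hJ
      exact this hσ
    exact add_mem (add_mem (Submodule.mem_sup_left t1) (Submodule.mem_sup_right t2))
      (add_mem (Submodule.mem_sup_left hτ) (Submodule.mem_sup_right t3))

end ExactMulticomplex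

end Abstract

/-! ### Smooth dependence of integrals on parameters -/

section ParametricIntegral

universe u

open MeasureTheory

lemma hasFDerivAt_intervalIntegral_param {E G : Type*} [NormedAddCommGroup E]
    [NormedSpace ℝ E] [FiniteDimensional ℝ E] [NormedAddCommGroup G] [NormedSpace ℝ G]
    {F : E × ℝ → G} (hF : ContDiff ℝ 1 F) (x₀ : E) :
    HasFDerivAt (fun x => ∫ t in (0 : ℝ)..1, F (x, t))
      (∫ t in (0 : ℝ)..1, (fderiv ℝ F (x₀, t)).comp (ContinuousLinearMap.inl ℝ E ℝ)) x₀ := by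
  have : ProperSpace E := FiniteDimensional.proper ℝ E
  have hF' : Continuous fun p : E × ℝ =>
      (fderiv ℝ F p).comp (ContinuousLinearMap.inl ℝ E ℝ) :=
    (hF.continuous_fderiv one_ne_zero).clm_comp continuous_const
  -- A constant dominating function comes from compactness of a closed ball times the interval.
  have hK : IsCompact (Metric.closedBall x₀ 1 ×ˢ Set.Icc (0 : ℝ) 1) :=
    (isCompact_closedBall x₀ 1).prod isCompact_Icc
  obtain ⟨C, hC⟩ := hK.exists_bound_of_continuousOn hF'.continuousOn
  refine (intervalIntegral.hasFDerivAt_integral_of_dominated_of_fderiv_le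
    (F := fun x t => F (x, t))
    (F' := fun x t => (fderiv ℝ F (x, t)).comp (ContinuousLinearMap.inl ℝ E ℝ))
    (bound := fun _ => C) (Metric.closedBall_mem_nhds x₀ one_pos)
    ?_ ?_ ?_ ?_ ?_ ?_)
  · exact .of_forall fun x =>
      (hF.continuous.comp (Continuous.prodMk_right x)).aestronglyMeasurable
  · exact (hF.continuous.comp (Continuous.prodMk_right x₀)).intervalIntegrable _ _
  · exact (hF'.comp (Continuous.prodMk_right x₀)).aestronglyMeasurable
  · refine .of_forall fun t ht x hx => hC (x, t) ⟨hx, ?_⟩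
    rw [Set.uIoc_of_le zero_le_one] at ht
    exact ⟨ht.1.le, ht.2⟩
  · exact intervalIntegrable_const
  · refine .of_forall fun t _ x _ => ?_
    have h1 : HasFDerivAt (fun y : E => (y, t)) (ContinuousLinearMap.inl ℝ E ℝ) x :=
      hasFDerivAt_prodMk_left x t
    exact ((hF.differentiable one_ne_zero (x, t)).hasFDerivAt).comp x h1

open scoped ContDiff in
-- The derivative is an integral of the same kind with values in `E →L[ℝ] G`, so the induction must
-- vary `G`; the common universe keeps that space in range.
lemma contDiff_intervalIntegral_param {E : Type u} [NormedAddCommGroup E]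
    [NormedSpace ℝ E] [FiniteDimensional ℝ E] (n : ℕ) :
    ∀ {G : Type u} [NormedAddCommGroup G] [NormedSpace ℝ G] {F : E × ℝ → G},
      ContDiff ℝ ∞ F → ContDiff ℝ n (fun x => ∫ t in (0 : ℝ)..1, F (x, t)) := by
  induction n with
  | zero =>
    intro G _ _ F hF
    refine contDiff_zero.mpr (continuous_iff_continuousAt.mpr fun x => ?_)
    exact (hasFDerivAt_intervalIntegral_param (hF.of_le (by simp)) x).continuousAt
  | succ n ih =>
    intro G _ _ F hF
    have h1 := fun x => hasFDerivAt_intervalIntegral_param (hF.of_le (by simp)) x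
    have : ((n + 1 : ℕ) : ℕ∞ω) = (n : ℕ∞ω) + 1 := by norm_cast
    rw [this, contDiff_succ_iff_fderiv]
    refine ⟨fun x => (h1 x).differentiableAt, by simp, ?_⟩
    rw [funext fun x => (h1 x).fderiv]
    exact ih (F := fun p => (fderiv ℝ F p).comp (ContinuousLinearMap.inl ℝ E ℝ))
      ((hF.fderiv_right (by simp)).clm_comp contDiff_const)

end ParametricIntegral

/-! ### Partial derivatives, restrictions and primitives of smooth functions -/

noncomputable section

open scoped Manifold ContDiff TensorProduct

variable {D : ℕ}

lemma Smooth.contDiff (f : Smooth D) : ContDiff ℝ ∞ f := f.contMDiff.contDiff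

/-- The unit vector in the direction of `x^μ`. -/
abbrev unitVector (μ : Fin D) : Space D := EuclideanSpace.single μ 1

lemma partialDeriv_apply (μ : Fin D) (f : Smooth D) (x : Space D) :
    partialDeriv μ f x = fderiv ℝ f x (unitVector μ) := rfl

lemma hasDerivAt_line (μ : Fin D) (f : Smooth D) (x : Space D) (t : ℝ) :
    HasDerivAt (fun s : ℝ => f (x + s • unitVector μ))
      (partialDeriv μ f (x + t • unitVector μ)) t := by
  have h1 : HasDerivAt (fun s : ℝ => x + s • unitVector μ) (unitVector μ) t := by
    simpa using ((hasDerivAt_id t).smul_const (unitVector μ)).const_add x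
  exact ((f.contDiff.differentiable (by simp) _).hasFDerivAt).comp_hasDerivAt t h1

lemma partialDeriv_comm (μ ν : Fin D) (f : Smooth D) :
    partialDeriv μ (partialDeriv ν f) = partialDeriv ν (partialDeriv μ f) := by
  have key : ∀ (μ ν : Fin D) (x : Space D), partialDeriv μ (partialDeriv ν f) x =
      fderiv ℝ (fderiv ℝ f) x (unitVector μ) (unitVector ν) := by
    intro μ ν x
    have hd : DifferentiableAt ℝ (fderiv ℝ f) x :=
      (f.contDiff.fderiv_right (m := ∞) (by simp)).differentiable (by simp) x
    have h := hd.hasFDerivAt.clm_apply (hasFDerivAt_const (unitVector ν) x)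
    change fderiv ℝ (fun y => fderiv ℝ f y (unitVector ν)) x (unitVector μ) = _
    rw [h.fderiv]
    simp
  ext x
  rw [key, key]
  exact (f.contDiff.contDiffAt.isSymmSndFDerivAt (by
    simpa using WithTop.coe_le_coe.mpr (le_top : (2 : ℕ∞) ≤ ⊤))).eq _ _

/-- The projection of `ℝ^D` setting to zero the coordinates in `T`. -/
def zeroOut (T : Finset (Fin D)) : Space D →L[ℝ] Space D :=
  LinearMap.toContinuousLinearMap
    { toFun := fun x => WithLp.toLp 2 fun i => if i ∈ T then 0 else x i
      map_add' := fun x y => by ext i; by_cases h : i ∈ T <;> simp [h]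
      map_smul' := fun c x => by ext i; by_cases h : i ∈ T <;> simp [h] }

lemma zeroOut_apply (T : Finset (Fin D)) (x : Space D) (i : Fin D) :
    zeroOut T x i = if i ∈ T then 0 else x i := rfl

lemma zeroOut_unitVector (T : Finset (Fin D)) (μ : Fin D) :
    zeroOut T (unitVector μ) = if μ ∈ T then 0 else unitVector μ := by
  ext i
  rw [zeroOut_apply]
  by_cases h : i = μ
  · subst h
    split_ifs <;> simp
  · split_ifs <;> simp [h]

lemma zeroOut_add_smul (μ : Fin D) (x : Space D) :
    zeroOut {μ} x + x μ • unitVector μ = x := by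
  ext i
  by_cases h : i = μ
  · subst h; simp [zeroOut_apply]
  · simp [zeroOut_apply, h]

/-- Restriction of functions to the subspace where the coordinates in `T` vanish. -/
def restrict (T : Finset (Fin D)) : Smooth D →ₗ[ℝ] Smooth D where
  toFun f := ⟨fun x => f (zeroOut T x), (f.contDiff.comp (zeroOut T).contDiff).contMDiff⟩
  map_add' _ _ := rfl
  map_smul' _ _ := rfl

lemma restrict_apply (T : Finset (Fin D)) (f : Smooth D) (x : Space D) :
    restrict T f x = f (zeroOut T x) := rfl

lemma restrict_empty (f : Smooth D) : restrict ∅ f = f := by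
  ext x
  rw [restrict_apply]
  congr 1

lemma restrict_univ_apply (f : Smooth D) (x : Space D) :
    restrict Finset.univ f x = f 0 := by
  rw [restrict_apply]
  congr 1
  ext i
  simp [zeroOut_apply]

lemma restrict_restrict (μ : Fin D) (T : Finset (Fin D)) (f : Smooth D) :
    restrict {μ} (restrict T f) = restrict (insert μ T) f := by
  ext x
  simp only [restrict_apply]
  congr 1
  ext i
  simp only [zeroOut_apply, Finset.mem_insert, Finset.mem_singleton]
  split_ifs <;> tauto

lemma partialDeriv_restrict (μ : Fin D) (T : Finset (Fin D)) (f : Smooth D) :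
    partialDeriv μ (restrict T f) = if μ ∈ T then 0 else restrict T (partialDeriv μ f) := by
  ext x
  have h : fderiv ℝ (fun y => f (zeroOut T y)) x =
      (fderiv ℝ f (zeroOut T x)).comp (zeroOut T) :=
    ((f.contDiff.differentiable (by simp) _).hasFDerivAt.comp x
      (zeroOut T).hasFDerivAt).fderiv
  rw [partialDeriv_apply]
  change fderiv ℝ (fun y => f (zeroOut T y)) x _ = _
  rw [h, ContinuousLinearMap.comp_apply, zeroOut_unitVector]
  split_ifs
  · simp
  · rfl

lemma continuous_line (μ : Fin D) (f : Smooth D) (x : Space D) :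
    Continuous fun s : ℝ => f (x + s • unitVector μ) :=
  f.contDiff.continuous.comp (by fun_prop)

/-- The primitive of `f` in the direction of `x^μ` which vanishes for `x^μ = 0`. -/
def primitive (μ : Fin D) : Smooth D →ₗ[ℝ] Smooth D where
  toFun f := ⟨fun x => x μ * ∫ t in (0 : ℝ)..1,
      f (zeroOut {μ} x + (t * x μ) • unitVector μ), by
    refine ContDiff.contMDiff (contDiff_infty.mpr fun n => ?_)
    refine ContDiff.mul (EuclideanSpace.proj (𝕜 := ℝ) μ).contDiff ?_
    refine contDiff_intervalIntegral_param n (F := fun p : Space D × ℝ =>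
      f (zeroOut {μ} p.1 + (p.2 * p.1 μ) • unitVector μ)) (f.contDiff.comp ?_)
    have h1 : ContDiff ℝ ∞ fun p : Space D × ℝ => p.1 μ :=
      (EuclideanSpace.proj (𝕜 := ℝ) μ).contDiff.comp contDiff_fst
    exact ((zeroOut {μ}).contDiff.comp contDiff_fst).add
      ((contDiff_snd.mul h1).smul contDiff_const)⟩
  map_add' f g := by
    ext x
    have hc : ∀ f : Smooth D, IntervalIntegrable
        (fun t : ℝ => f (zeroOut {μ} x + (t * x μ) • unitVector μ)) MeasureTheory.volume 0 1 :=
      fun f => (f.contDiff.continuous.comp (by fun_prop)).intervalIntegrable _ _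
    change x μ * ∫ t in (0 : ℝ)..1, (f _ + g _) = x μ * _ + x μ * _
    rw [intervalIntegral.integral_add (hc f) (hc g), mul_add]
  map_smul' c f := by
    ext x
    change x μ * ∫ t in (0 : ℝ)..1, c * f _ = c * (x μ * _)
    rw [intervalIntegral.integral_const_mul, mul_left_comm]

/-- Rescaling of the variable: the definition has fixed endpoints, suited to smoothness in `x`,
while this form suits the fundamental theorem of calculus. -/
lemma primitive_apply (μ : Fin D) (f : Smooth D) (x : Space D) :
    primitive μ f x = ∫ s in (0 : ℝ)..x μ, f (zeroOut {μ} x + s • unitVector μ) := by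
  change x μ * ∫ t in (0 : ℝ)..1, f (zeroOut {μ} x + (t * x μ) • unitVector μ) = _
  have := intervalIntegral.smul_integral_comp_mul_right (a := 0) (b := 1)
    (fun s : ℝ => f (zeroOut {μ} x + s • unitVector μ)) (x μ)
  simpa using this

lemma restrict_add_primitive (μ : Fin D) (f : Smooth D) :
    restrict {μ} f + primitive μ (partialDeriv μ f) = f := by
  ext x
  change restrict {μ} f x + primitive μ (partialDeriv μ f) x = f x
  rw [primitive_apply, restrict_apply,
    intervalIntegral.integral_eq_sub_of_hasDerivAt
      (fun t _ => hasDerivAt_line μ f (zeroOut {μ} x) t)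
      ((continuous_line μ (partialDeriv μ f) _).intervalIntegrable _ _),
    zeroOut_add_smul]
  simp

lemma partialDeriv_primitive_self (μ : Fin D) (f : Smooth D) :
    partialDeriv μ (primitive μ f) = f := by
  ext x
  have h1 := hasDerivAt_line μ (primitive μ f) (zeroOut {μ} x) (x μ)
  have h2 : (fun s : ℝ => primitive μ f (zeroOut {μ} x + s • unitVector μ)) =
      fun s => ∫ u in (0 : ℝ)..s, f (zeroOut {μ} x + u • unitVector μ) := by
    funext s
    have e : zeroOut {μ} (zeroOut {μ} x + s • unitVector μ) = zeroOut {μ} x := by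
      ext i
      by_cases h : i = μ <;> simp [zeroOut_apply, h]
    rw [primitive_apply, e]
    simp [zeroOut_apply]
  rw [h2, zeroOut_add_smul] at h1
  have h3 := (continuous_line μ f (zeroOut {μ} x)).deriv_integral
    (fun s : ℝ => f (zeroOut {μ} x + s • unitVector μ)) 0 (x μ)
  rw [← h1.deriv, h3, zeroOut_add_smul]

lemma restrict_primitive (μ : Fin D) (f : Smooth D) : restrict {μ} (primitive μ f) = 0 := by
  have h := restrict_add_primitive μ (primitive μ f)
  rwa [partialDeriv_primitive_self, add_eq_right] at h

/-- No differentiation under the integral sign is needed: `partialDeriv ν (primitive μ f)` vanishes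
for `x^μ = 0` and its derivative along `x^μ` is `partialDeriv ν f`, so `restrict_add_primitive`
identifies it. -/
lemma partialDeriv_primitive {μ ν : Fin D} (h : ν ≠ μ) (f : Smooth D) :
    partialDeriv ν (primitive μ f) = primitive μ (partialDeriv ν f) := by
  have h1 := restrict_add_primitive μ (partialDeriv ν (primitive μ f))
  have h2 := partialDeriv_restrict ν {μ} (primitive μ f)
  rw [if_neg (by simpa using h), restrict_primitive, map_zero] at h2
  rw [← h2, zero_add, partialDeriv_comm, partialDeriv_primitive_self] at h1
  exact h1.symm

/-! ### Order of vanishing at the origin -/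

/-- Evaluation at the origin. -/
def evalZero (D : ℕ) : Smooth D →ₗ[ℝ] ℝ where
  toFun f := f 0
  map_add' _ _ := rfl
  map_smul' _ _ := rfl

lemma evalZero_apply (f : Smooth D) : evalZero D f = f 0 := rfl

/-- The functions all of whose partial derivatives of order `< s` vanish at the origin. -/
def vanishing (D : ℕ) : ℕ → Submodule ℝ (Smooth D)
  | 0 => ⊤
  | s + 1 => LinearMap.ker (evalZero D) ⊓ ⨅ μ, (vanishing D s).comap (partialDeriv μ)

lemma mem_vanishing_succ {s : ℕ} {f : Smooth D} :
    f ∈ vanishing D (s + 1) ↔ f 0 = 0 ∧ ∀ μ, partialDeriv μ f ∈ vanishing D s := by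
  simp [vanishing, evalZero_apply]

lemma primitive_zero_eq (μ : Fin D) (f : Smooth D) : primitive μ f 0 = 0 := by
  rw [primitive_apply]
  simp

lemma primitive_mem_vanishing (μ : Fin D) (s : ℕ) :
    ∀ f ∈ vanishing D s, primitive μ f ∈ vanishing D (s + 1) := by
  induction s with
  | zero =>
    intro f _
    exact mem_vanishing_succ.mpr ⟨primitive_zero_eq μ f, fun _ => Submodule.mem_top⟩
  | succ s ih =>
    intro f hf
    refine mem_vanishing_succ.mpr ⟨primitive_zero_eq μ f, fun ν => ?_⟩
    by_cases h : ν = μ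
    · rw [h, partialDeriv_primitive_self]
      exact hf
    · rw [partialDeriv_primitive h]
      exact ih _ ((mem_vanishing_succ.mp hf).2 ν)

lemma restrict_mem_vanishing (T : Finset (Fin D)) (s : ℕ) :
    ∀ f ∈ vanishing D s, restrict T f ∈ vanishing D s := by
  induction s with
  | zero => exact fun _ _ => Submodule.mem_top
  | succ s ih =>
    intro f hf
    rw [mem_vanishing_succ] at hf ⊢
    refine ⟨by rw [restrict_apply, map_zero, hf.1], fun μ => ?_⟩
    rw [partialDeriv_restrict]
    split_ifs
    · exact zero_mem _
    · exact ih _ (hf.2 μ)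

lemma restrict_univ_eq_zero {s : ℕ} {f : Smooth D} (hf : f ∈ vanishing D (s + 1)) :
    restrict Finset.univ f = 0 := by
  ext x
  rw [restrict_univ_apply, (mem_vanishing_succ.mp hf).1]
  rfl

/-! ### Polynomial functions and Taylor's formula -/

/-- The coordinate function `x^μ`. -/
def coord (μ : Fin D) : Smooth D :=
  ⟨fun x => x μ, (EuclideanSpace.proj (𝕜 := ℝ) μ).contDiff.contMDiff⟩

/-- The polynomial function defined by a polynomial. -/
def polyFun (D : ℕ) : MvPolynomial (Fin D) ℝ →ₐ[ℝ] Smooth D := MvPolynomial.aeval coord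

lemma polyFun_apply (p : MvPolynomial (Fin D) ℝ) (x : Space D) :
    polyFun D p x = MvPolynomial.eval (fun μ => x μ) p := by
  induction p using MvPolynomial.induction_on with
  | C a => rw [polyFun, MvPolynomial.aeval_C, MvPolynomial.eval_C]; rfl
  | add p q hp hq => rw [map_add, map_add, ← hp, ← hq]; rfl
  | mul_X p i hp =>
    rw [map_mul, map_mul, ← hp, MvPolynomial.eval_X, polyFun, MvPolynomial.aeval_X]; rfl

lemma partialDeriv_mul (μ : Fin D) (f g : Smooth D) :
    partialDeriv μ (f * g) = f * partialDeriv μ g + g * partialDeriv μ f := by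
  ext x
  change fderiv ℝ (fun y => f y * g y) x _ = f x * fderiv ℝ g x _ + g x * fderiv ℝ f x _
  rw [fderiv_fun_mul (f.contDiff.differentiable (by simp) x)
    (g.contDiff.differentiable (by simp) x)]
  rfl

lemma partialDeriv_algebraMap (μ : Fin D) (c : ℝ) :
    partialDeriv μ (algebraMap ℝ (Smooth D) c) = 0 := by
  ext x
  change fderiv ℝ (fun _ => c) x (unitVector μ) = 0
  simp

lemma partialDeriv_coord (μ ν : Fin D) :
    partialDeriv μ (coord ν) = if μ = ν then 1 else 0 := by
  ext x
  have : partialDeriv μ (coord ν) x = unitVector μ ν :=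
    congrArg (fun L : Space D →L[ℝ] ℝ => L (unitVector μ))
      (EuclideanSpace.proj (𝕜 := ℝ) ν).fderiv
  rw [this]
  split_ifs with h
  · subst h; simp
  · simp [Ne.symm h]

lemma partialDeriv_polyFun (μ : Fin D) (p : MvPolynomial (Fin D) ℝ) :
    partialDeriv μ (polyFun D p) = polyFun D (MvPolynomial.pderiv μ p) := by
  induction p using MvPolynomial.induction_on with
  | C a => rw [polyFun, MvPolynomial.aeval_C, partialDeriv_algebraMap]; simp
  | add p q hp hq => simp only [map_add, hp, hq]
  | mul_X p i hp =>
    have hX : polyFun D (MvPolynomial.X i) = coord i := MvPolynomial.aeval_X _ _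
    rw [map_mul, partialDeriv_mul, hp, Derivation.leibniz, map_add, smul_eq_mul, smul_eq_mul,
      map_mul, map_mul, hX, partialDeriv_coord, MvPolynomial.pderiv_X]
    congr 2
    by_cases h : μ = i
    · subst h; simp
    · simp [h, Ne.symm h]

/-- The polynomial functions of degree `< m`. -/
def polynomialsLT (D m : ℕ) : Submodule ℝ (Smooth D) :=
  Submodule.span ℝ {f | ∃ s : Fin D →₀ ℕ, s.degree < m ∧ f = polyFun D (.monomial s 1)}

lemma IsPolynomialLT.of_mem {m : ℕ} {f : Smooth D} (hf : f ∈ polynomialsLT D m) :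
    IsPolynomialLT m f := by
  classical
  induction hf using Submodule.span_induction with
  | mem f h =>
    obtain ⟨s, hs, rfl⟩ := h
    refine ⟨.monomial s 1, fun t ht => ?_, polyFun_apply _⟩
    rw [Finset.mem_singleton.mp (MvPolynomial.support_monomial_subset ht)]
    exact hs
  | zero => exact ⟨0, by simp, fun x => by rw [map_zero]; rfl⟩
  | add f g _ _ hf hg =>
    obtain ⟨p, hp, hp'⟩ := hf
    obtain ⟨q, hq, hq'⟩ := hg
    refine ⟨p + q, fun s hs => ?_, fun x => by rw [map_add, ← hp', ← hq']; rfl⟩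
    rcases Finset.mem_union.mp (MvPolynomial.support_add hs) with h | h
    exacts [hp s h, hq s h]
  | smul c f _ hf =>
    obtain ⟨p, hp, hp'⟩ := hf
    exact ⟨c • p, fun s hs => hp s (MvPolynomial.support_smul hs),
      fun x => by rw [MvPolynomial.smul_eval, ← hp']; rfl⟩

lemma polynomialsLT_zero : polynomialsLT D 0 = ⊥ := by
  simp [polynomialsLT]

lemma partialDeriv_mem_polynomialsLT (μ : Fin D) (m : ℕ) :
    ∀ f ∈ polynomialsLT D (m + 1), partialDeriv μ f ∈ polynomialsLT D m := by
  change polynomialsLT D (m + 1) ≤ (polynomialsLT D m).comap (partialDeriv μ)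
  refine Submodule.span_le.mpr ?_
  rintro _ ⟨s, hs, rfl⟩
  rw [SetLike.mem_coe, Submodule.mem_comap, partialDeriv_polyFun, MvPolynomial.pderiv_monomial,
    one_mul, ← mul_one (s μ : ℝ), ← smul_eq_mul, ← MvPolynomial.smul_monomial, map_smul]
  by_cases h : s μ = 0
  · simp [h]
  refine Submodule.smul_mem _ _ (Submodule.subset_span ⟨_, ?_, rfl⟩)
  have h1 : Finsupp.single μ 1 ≤ s := by
    rw [Finsupp.single_le_iff]; omega
  have h2 := congrArg Finsupp.degree (tsub_add_cancel_of_le h1)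
  rw [map_add, Finsupp.degree_single] at h2
  omega

lemma primitive_mem_polynomialsLT (μ : Fin D) (m : ℕ) :
    ∀ f ∈ polynomialsLT D m, primitive μ f ∈ polynomialsLT D (m + 1) := by
  change polynomialsLT D m ≤ (polynomialsLT D (m + 1)).comap (primitive μ)
  refine Submodule.span_le.mpr ?_
  rintro _ ⟨s, hs, rfl⟩
  -- The monomial `q` vanishes for `x^μ = 0`, so it is the primitive of its own derivative; this
  -- avoids computing an integral.
  set q : Smooth D := polyFun D (.monomial (s + Finsupp.single μ 1) 1)
  have h1 : partialDeriv μ q = ((s μ : ℝ) + 1) • polyFun D (.monomial s 1) := by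
    rw [partialDeriv_polyFun, MvPolynomial.pderiv_monomial, ← map_smul,
      MvPolynomial.smul_monomial]
    simp
  have h2 : restrict {μ} q = 0 := by
    ext x
    rw [restrict_apply, polyFun_apply, MvPolynomial.eval_monomial, one_mul]
    refine Finset.prod_eq_zero (i := μ) (by simp) ?_
    simp [zeroOut_apply]
  have h3 := restrict_add_primitive μ q
  rw [h1, h2, zero_add, map_smul] at h3
  have h4 : primitive μ (polyFun D (.monomial s 1)) = ((s μ : ℝ) + 1)⁻¹ • q := by
    rw [← h3, smul_smul, inv_mul_cancel₀ (by positivity), one_smul]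
  rw [SetLike.mem_coe, Submodule.mem_comap, h4]
  refine Submodule.smul_mem _ _ (Submodule.subset_span ⟨_, ?_, rfl⟩)
  rw [map_add, Finsupp.degree_single]
  omega

/-- Taylor's formula: up to a polynomial function of degree `< m`, every smooth function vanishes
to order `m` at the origin. -/
lemma mem_polynomialsLT_sup_vanishing (m : ℕ) :
    ∀ f : Smooth D, f ∈ polynomialsLT D m ⊔ vanishing D m := by
  induction m with
  | zero => exact fun f => Submodule.mem_sup_right Submodule.mem_top
  | succ m ih =>
    intro f
    -- The coordinates are set to zero one by one. Each increment is the primitive of a partial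
    -- derivative, and primitives raise both the degree bound and the order of vanishing by one;
    -- what remains at the end is the constant `f 0`.
    have key : ∀ T : Finset (Fin D),
        f - restrict T f ∈ polynomialsLT D (m + 1) ⊔ vanishing D (m + 1) := by
      intro T
      induction T using Finset.induction_on with
      | empty => rw [restrict_empty, sub_self]; exact zero_mem _
      | insert μ T _ ihT =>
        obtain ⟨p, hp, g, hg, e⟩ := Submodule.mem_sup.mp (ih (partialDeriv μ (restrict T f)))
        have h := restrict_add_primitive μ (restrict T f)
        rw [← e, map_add, restrict_restrict] at h
        have : f - restrict (insert μ T) f =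
            (f - restrict T f) + (primitive μ p + primitive μ g) := by
          rw [← h]; abel
        rw [this]
        exact add_mem ihT (add_mem
          (Submodule.mem_sup_left (primitive_mem_polynomialsLT μ m p hp))
          (Submodule.mem_sup_right (primitive_mem_vanishing μ m g hg)))
    have hc : restrict Finset.univ f ∈ polynomialsLT D (m + 1) := by
      have : restrict Finset.univ f = f 0 • polyFun D (.monomial 0 1) := by
        ext x
        change _ = f 0 * polyFun D (.monomial 0 1) x
        rw [restrict_univ_apply, polyFun_apply]
        simp
      rw [this]
      exact Submodule.smul_mem _ _ (Submodule.subset_span ⟨0, by simp, rfl⟩)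
    simpa using add_mem (key Finset.univ) (Submodule.mem_sup_left hc)

end

/-! ### Degree in one copy and truncation -/

noncomputable section

open scoped TensorProduct Polynomial

variable {n D : ℕ}

/-- The projection of `(ℝ^{D*})^n` onto its `i`-th summand. -/
def copyProj (n D : ℕ) (i : Fin n) :
    (Fin n → Module.Dual ℝ (Space D)) →ₗ[ℝ] (Fin n → Module.Dual ℝ (Space D)) :=
  LinearMap.single ℝ _ i ∘ₗ LinearMap.proj i

/-- The map `v ↦ v` on the copies other than the `i`-th one, and `v ↦ v X` on the `i`-th copy. -/
def weightMap (n D : ℕ) (i : Fin n) :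
    (Fin n → Module.Dual ℝ (Space D)) →ₗ[ℝ] (ConstForms n D)[X] where
  toFun v := .C (ExteriorAlgebra.ι ℝ (v - copyProj n D i v)) +
    .C (ExteriorAlgebra.ι ℝ (copyProj n D i v)) * .X
  map_add' v w := by
    simp only [map_add, map_sub, add_mul]
    abel
  map_smul' c v := by
    simp only [map_smul, ← smul_sub, ← Polynomial.smul_C, smul_add, smul_mul_assoc,
      RingHom.id_apply]

/-- The algebra morphism multiplying a form of degree `p` in the `i`-th copy by `X ^ p`. -/
def weightHom (n D : ℕ) (i : Fin n) : ConstForms n D →ₐ[ℝ] (ConstForms n D)[X] :=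
  ExteriorAlgebra.lift ℝ ⟨weightMap n D i, fun v => by
    set a := ExteriorAlgebra.ι ℝ (v - copyProj n D i v)
    set b := ExteriorAlgebra.ι ℝ (copyProj n D i v)
    have haa : a * a = 0 := ExteriorAlgebra.ι_sq_zero _
    have hbb : b * b = 0 := ExteriorAlgebra.ι_sq_zero _
    have hab : a * b + b * a = 0 := ExteriorAlgebra.ι_add_mul_swap _ _
    change (Polynomial.C a + Polynomial.C b * .X) * (Polynomial.C a + Polynomial.C b * .X) = 0
    have h1 : (Polynomial.C b * .X) * Polynomial.C a = Polynomial.C (b * a) * .X := by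
      rw [mul_assoc, Polynomial.X_mul_C, ← mul_assoc, Polynomial.C_mul]
    have h2 : (Polynomial.C b * .X) * (Polynomial.C b * .X) =
        Polynomial.C (b * b) * .X * .X := by
      rw [mul_assoc, ← mul_assoc Polynomial.X, Polynomial.X_mul_C, Polynomial.C_mul]
      simp only [mul_assoc]
    have h3 : Polynomial.C a * (Polynomial.C b * .X) = Polynomial.C (a * b) * .X := by
      rw [← mul_assoc, Polynomial.C_mul]
    rw [add_mul, mul_add, mul_add, h1, h2, h3, ← Polynomial.C_mul, haa, hbb]
    simp only [map_zero, zero_mul, zero_add, add_zero]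
    rw [← add_mul, ← Polynomial.C_add, hab, map_zero, zero_mul]⟩

lemma weightHom_ι_mul (i : Fin n) (v : Fin n → Module.Dual ℝ (Space D)) (a : ConstForms n D) :
    weightHom n D i (ExteriorAlgebra.ι ℝ v * a) =
      .C (ExteriorAlgebra.ι ℝ (v - copyProj n D i v)) * weightHom n D i a +
      .C (ExteriorAlgebra.ι ℝ (copyProj n D i v)) * (weightHom n D i a * .X) := by
  rw [map_mul, weightHom, ExteriorAlgebra.lift_ι_apply]
  change (Polynomial.C (ExteriorAlgebra.ι ℝ (v - copyProj n D i v)) +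
    Polynomial.C (ExteriorAlgebra.ι ℝ (copyProj n D i v)) * Polynomial.X) * _ = _
  rw [add_mul, mul_assoc, Polynomial.X_mul]

lemma weightHom_dx_mul_self (i : Fin n) (μ : Fin D) (a : ConstForms n D) :
    weightHom n D i (dx i μ * a) = .C (dx i μ) * (weightHom n D i a * .X) := by
  have : copyProj n D i (Pi.single i ((EuclideanSpace.proj μ : Space D →L[ℝ] ℝ) :
      Module.Dual ℝ (Space D))) = Pi.single i ((EuclideanSpace.proj μ : Space D →L[ℝ] ℝ) :
      Module.Dual ℝ (Space D)) := by
    simp [copyProj]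
  rw [dx, weightHom_ι_mul, this, sub_self, map_zero, map_zero, zero_mul, zero_add]

lemma weightHom_dx_mul {i j : Fin n} (h : i ≠ j) (μ : Fin D) (a : ConstForms n D) :
    weightHom n D i (dx j μ * a) = .C (dx j μ) * weightHom n D i a := by
  have : copyProj n D i (Pi.single j ((EuclideanSpace.proj μ : Space D →L[ℝ] ℝ) :
      Module.Dual ℝ (Space D))) = 0 := by
    simp [copyProj, h]
  rw [dx, weightHom_ι_mul, this, sub_zero, map_zero, map_zero, zero_mul, add_zero]

/-- The coefficients of `weightHom` are the homogeneous components in copy `i`, obtained without a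
basis; setting `X = 1` adds them up again. -/
lemma eval_one_weightHom (i : Fin n) (a : ConstForms n D) :
    (weightHom n D i a).eval 1 = a := by
  induction a using CliffordAlgebra.left_induction with
  | algebraMap r =>
    rw [AlgHom.commutes, Polynomial.algebraMap_apply, Polynomial.eval_C]
  | add a b ha hb => rw [map_add, Polynomial.eval_add, ha, hb]
  | ι_mul a v ha =>
    change (weightHom n D i (ExteriorAlgebra.ι ℝ v * a)).eval 1 = ExteriorAlgebra.ι ℝ v * a
    rw [weightHom_ι_mul, Polynomial.eval_add, Polynomial.eval_C_mul, Polynomial.eval_C_mul,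
      Polynomial.eval_mul_X, ha, mul_one, ← add_mul, ← map_add, sub_add_cancel]

/-- The truncation of constant forms to degrees `< p` in the `i`-th copy. -/
def truncConst (n D : ℕ) (i : Fin n) (p : ℕ) : ConstForms n D →ₗ[ℝ] ConstForms n D where
  toFun a := ∑ q ∈ Finset.range p, (weightHom n D i a).coeff q
  map_add' a b := by simp [Finset.sum_add_distrib]
  map_smul' c a := by simp [Finset.smul_sum]

lemma truncConst_apply (i : Fin n) (p : ℕ) (a : ConstForms n D) :
    truncConst n D i p a = ∑ q ∈ Finset.range p, (weightHom n D i a).coeff q := rfl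

lemma truncConst_dx_mul {i j : Fin n} (h : i ≠ j) (p : ℕ) (μ : Fin D) (a : ConstForms n D) :
    truncConst n D i p (dx j μ * a) = dx j μ * truncConst n D i p a := by
  simp only [truncConst_apply, weightHom_dx_mul h, Polynomial.coeff_C_mul, Finset.mul_sum]

lemma truncConst_dx_mul_self (i : Fin n) (p : ℕ) (μ : Fin D) (a : ConstForms n D) :
    truncConst n D i (p + 1) (dx i μ * a) = dx i μ * truncConst n D i p a := by
  simp only [truncConst_apply, weightHom_dx_mul_self, Polynomial.coeff_C_mul]
  rw [Finset.sum_range_succ', Polynomial.mul_coeff_zero, Polynomial.coeff_X_zero]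
  simp only [Polynomial.coeff_mul_X, mul_zero, add_zero, Finset.mul_sum]

lemma truncConst_eq_self (i : Fin n) (a : ConstForms n D) :
    ∃ p₀, ∀ p ≥ p₀, truncConst n D i p a = a := by
  refine ⟨(weightHom n D i a).natDegree + 1, fun p hp => ?_⟩
  have h := eval_one_weightHom i a
  rw [Polynomial.eval_eq_sum_range' (n := p) (by omega)] at h
  simpa [truncConst_apply] using h

/-- The truncation of multiforms to degrees `< p` in the `i`-th copy. -/
def trunc (n D : ℕ) (i : Fin n) (p : ℕ) : Module.End ℝ (Multiform n D) :=
  TensorProduct.map (truncConst n D i p) LinearMap.id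

lemma trunc_tmul (i : Fin n) (p : ℕ) (a : ConstForms n D) (f : Smooth D) :
    trunc n D i p (a ⊗ₜ f) = truncConst n D i p a ⊗ₜ f := rfl

lemma d_tmul (i : Fin n) (a : ConstForms n D) (f : Smooth D) :
    d i (a ⊗ₜ f) = ∑ μ, (dx i μ * a) ⊗ₜ[ℝ] partialDeriv μ f := by
  simp [d]

lemma dx_mul_dx (i j : Fin n) (μ ν : Fin D) :
    (dx i μ * dx j ν : ConstForms n D) = -(dx j ν * dx i μ) :=
  eq_neg_of_add_eq_zero_left (ExteriorAlgebra.ι_add_mul_swap _ _)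

lemma d_anticomm (i j : Fin n) (ω : Multiform n D) : d i (d j ω) = -d j (d i ω) := by
  induction ω using TensorProduct.induction_on with
  | zero => simp
  | add ω η hω hη => simp only [map_add, hω, hη, neg_add]
  | tmul a f =>
    simp only [d_tmul, map_sum]
    rw [Finset.sum_comm, ← Finset.sum_neg_distrib]
    refine Finset.sum_congr rfl fun μ _ => ?_
    rw [← Finset.sum_neg_distrib]
    refine Finset.sum_congr rfl fun ν _ => ?_
    rw [partialDeriv_comm, ← mul_assoc, ← mul_assoc, dx_mul_dx, neg_mul,
      TensorProduct.neg_tmul]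

lemma trunc_d {i j : Fin n} (h : i ≠ j) (p : ℕ) (ω : Multiform n D) :
    trunc n D i p (d j ω) = d j (trunc n D i p ω) := by
  induction ω using TensorProduct.induction_on with
  | zero => simp
  | add ω η hω hη => simp only [map_add, hω, hη]
  | tmul a f => simp only [d_tmul, map_sum, trunc_tmul, truncConst_dx_mul h]

lemma trunc_d_self (i : Fin n) (p : ℕ) (ω : Multiform n D) :
    trunc n D i (p + 1) (d i ω) = d i (trunc n D i p ω) := by
  induction ω using TensorProduct.induction_on with
  | zero => simp
  | add ω η hω hη => simp only [map_add, hω, hη]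
  | tmul a f => simp only [d_tmul, map_sum, trunc_tmul, truncConst_dx_mul_self]

/-- Stated for all large `p` so that the summands of a tensor can share one bound. -/
lemma trunc_eq_self (i : Fin n) (ω : Multiform n D) :
    ∃ p₀, ∀ p ≥ p₀, trunc n D i p ω = ω := by
  induction ω using TensorProduct.induction_on with
  | zero => exact ⟨0, fun p _ => map_zero _⟩
  | add ω η hω hη =>
    obtain ⟨p, hp⟩ := hω
    obtain ⟨q, hq⟩ := hη
    refine ⟨max p q, fun r hr => ?_⟩
    rw [map_add, hp r (le_of_max_le_left hr), hq r (le_of_max_le_right hr)]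
  | tmul a f =>
    obtain ⟨p, hp⟩ := truncConst_eq_self i a
    exact ⟨p, fun q hq => by rw [trunc_tmul, hp q hq]⟩

/-! ### Multiforms with restricted coefficients -/

/-- The multiforms with coefficients in a space `F` of functions. -/
def coeffIn (n : ℕ) (F : Submodule ℝ (Smooth D)) : Submodule ℝ (Multiform n D) :=
  Submodule.span ℝ {η | ∃ (a : ConstForms n D) (f : Smooth D), f ∈ F ∧ η = a ⊗ₜ f}

lemma tmul_mem_coeffIn (a : ConstForms n D) {F : Submodule ℝ (Smooth D)} {f : Smooth D}
    (hf : f ∈ F) : a ⊗ₜ f ∈ coeffIn n F :=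
  Submodule.subset_span ⟨a, f, hf, rfl⟩

lemma map_mem_coeffIn (A : Module.End ℝ (ConstForms n D)) {B : Module.End ℝ (Smooth D)}
    {F G : Submodule ℝ (Smooth D)} (h : ∀ f ∈ F, B f ∈ G) {ω : Multiform n D}
    (hω : ω ∈ coeffIn n F) : TensorProduct.map A B ω ∈ coeffIn n G := by
  have : coeffIn n F ≤ (coeffIn n G).comap (TensorProduct.map A B) := by
    refine Submodule.span_le.mpr ?_
    rintro _ ⟨a, f, hf, rfl⟩
    exact tmul_mem_coeffIn _ (h f hf)
  exact this hω

lemma d_mem_coeffIn (i : Fin n) {F G : Submodule ℝ (Smooth D)}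
    (h : ∀ μ, ∀ f ∈ F, partialDeriv μ f ∈ G) {ω : Multiform n D}
    (hω : ω ∈ coeffIn n F) : d i ω ∈ coeffIn n G := by
  rw [d, LinearMap.sum_apply]
  exact sum_mem fun μ _ => map_mem_coeffIn _ (h μ) hω

lemma coeffIn_bot : coeffIn n (⊥ : Submodule ℝ (Smooth D)) = ⊥ := by
  refine le_bot_iff.mp (Submodule.span_le.mpr ?_)
  rintro _ ⟨a, f, hf, rfl⟩
  rw [(Submodule.mem_bot ℝ).mp hf, TensorProduct.tmul_zero]
  exact zero_mem _

/-! ### Homotopy and the Poincaré lemma for one differential -/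

/-- Contraction of the `i`-th copy with the unit vector in the direction of `x^μ`. -/
def contract (n : ℕ) (i : Fin n) (μ : Fin D) : Module.End ℝ (ConstForms n D) :=
  CliffordAlgebra.contractLeft (Module.Dual.eval ℝ _ (unitVector μ) ∘ₗ LinearMap.proj i)

lemma contract_dx_mul (i : Fin n) (μ ν : Fin D) (a : ConstForms n D) :
    contract n i μ (dx i ν * a) = (if ν = μ then a else 0) - dx i ν * contract n i μ a := by
  refine (CliffordAlgebra.contractLeft_ι_mul _ _ _).trans ?_
  congr 1
  simp [ite_smul]

/-- The homotopy operator in the direction of `x^μ` for the differential `d i`. -/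
def homotopy (n : ℕ) (i : Fin n) (μ : Fin D) : Module.End ℝ (Multiform n D) :=
  TensorProduct.map (contract n i μ) (primitive μ)

lemma homotopy_tmul (i : Fin n) (μ : Fin D) (a : ConstForms n D) (f : Smooth D) :
    homotopy n i μ (a ⊗ₜ f) = contract n i μ a ⊗ₜ primitive μ f := rfl

/-- For `ν ≠ μ` the terms cancel, as contraction anticommutes with `dx i ν` and `primitive μ`
commutes with `partialDeriv ν`. For `ν = μ` the contraction identity gives ω, and the failure of
`primitive μ` to invert `partialDeriv μ` from the left gives the restriction term. -/
lemma d_homotopy_add (i : Fin n) (μ : Fin D) (ω : Multiform n D) :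
    d i (homotopy n i μ ω) + homotopy n i μ (d i ω) =
      ω - TensorProduct.map (contract n i μ ∘ₗ LinearMap.mulLeft ℝ (dx i μ)) (restrict {μ}) ω := by
  induction ω using TensorProduct.induction_on with
  | zero => simp
  | add ω η hω hη =>
    simp only [map_add]
    rw [add_add_add_comm, hω, hη]
    abel
  | tmul a f =>
    rw [homotopy_tmul, d_tmul, d_tmul, map_sum, ← Finset.sum_add_distrib,
      Finset.sum_eq_single μ]
    · have hf : primitive μ (partialDeriv μ f) = f - restrict {μ} f :=
        eq_sub_of_add_eq' (restrict_add_primitive μ f)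
      rw [homotopy_tmul, partialDeriv_primitive_self, hf, TensorProduct.tmul_sub,
        TensorProduct.map_tmul, LinearMap.comp_apply, LinearMap.mulLeft_apply, ← add_sub_assoc,
        ← TensorProduct.add_tmul, contract_dx_mul, if_pos rfl, add_sub_cancel]
    · intro ν _ hν
      rw [homotopy_tmul, contract_dx_mul, if_neg hν, partialDeriv_primitive hν, zero_sub,
        ← TensorProduct.add_tmul, add_neg_cancel, TensorProduct.zero_tmul]
    · simp

/-- The Poincaré lemma for `d j`, with control of the order of vanishing at the origin. -/
lemma mem_map_d_of_d_eq_zero (j : Fin n) (s : ℕ) (ω : Multiform n D)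
    (hω : ω ∈ coeffIn n (vanishing D (s + 1))) (h : d j ω = 0) :
    ω ∈ (coeffIn n (vanishing D (s + 2))).map (d j) := by
  -- Modulo exact forms, ω is pushed to the subspace where the coordinates in `T` vanish. The
  -- operator `A` never matters: for `T = univ` the restriction evaluates coefficients at the
  -- origin, where they are zero.
  have key : ∀ T : Finset (Fin D), ∃ A : Module.End ℝ (ConstForms n D),
      ω - TensorProduct.map A (restrict T) ω ∈ (coeffIn n (vanishing D (s + 2))).map (d j) := by
    intro T
    induction T using Finset.induction_on with
    | empty =>
      refine ⟨LinearMap.id, ?_⟩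
      have : restrict (∅ : Finset (Fin D)) = LinearMap.id := LinearMap.ext restrict_empty
      rw [this, TensorProduct.map_id, LinearMap.id_apply, sub_self]
      exact zero_mem _
    | insert μ T _ ih =>
      obtain ⟨A, hA⟩ := ih
      set η := TensorProduct.map A (restrict T) ω with hη
      have hηm : η ∈ coeffIn n (vanishing D (s + 1)) :=
        map_mem_coeffIn A (restrict_mem_vanishing T (s + 1)) hω
      have hηd : d j η = 0 := by
        obtain ⟨β, -, hβ⟩ := hA
        have := congrArg (d j) hβ
        rw [map_sub, h, zero_sub, eq_zero_of_eq_neg (d_anticomm j j β)] at this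
        exact neg_eq_zero.mp this.symm
      refine ⟨(contract n j μ ∘ₗ LinearMap.mulLeft ℝ (dx j μ)) ∘ₗ A, ?_⟩
      have hr : restrict (insert μ T) = restrict {μ} ∘ₗ restrict T :=
        LinearMap.ext fun f => (restrict_restrict μ T f).symm
      have hh := d_homotopy_add j μ η
      rw [hηd, map_zero, add_zero] at hh
      rw [hr, TensorProduct.map_comp, LinearMap.comp_apply, ← hη,
        ← sub_add_sub_cancel ω η, ← hh]
      exact add_mem hA (Submodule.mem_map_of_mem
        (map_mem_coeffIn _ (primitive_mem_vanishing μ (s + 1)) hηm))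
  obtain ⟨A, hA⟩ := key Finset.univ
  have h0 : TensorProduct.map A (restrict Finset.univ) ω ∈
      coeffIn n (⊥ : Submodule ℝ (Smooth D)) :=
    map_mem_coeffIn A (fun f hf => (Submodule.mem_bot ℝ).mpr (restrict_univ_eq_zero hf)) hω
  rw [coeffIn_bot, Submodule.mem_bot] at h0
  rwa [h0, sub_zero] at hA

lemma exactMulticomplex_multiform (n D : ℕ) :
    ExactMulticomplex (d : Fin n → Module.End ℝ (Multiform n D))
      (fun s => coeffIn n (vanishing D s)) (trunc n D) where
  anticomm := d_anticomm
  d_mem i s _ hω := d_mem_coeffIn i (fun μ _ hf => (mem_vanishing_succ.mp hf).2 μ) hω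
  exact := mem_map_d_of_d_eq_zero
  trunc_mem i p s _ hω := map_mem_coeffIn _ (fun _ hf => hf) hω
  trunc_zero i ω := by
    have : truncConst n D i 0 = 0 := by ext a; simp [truncConst_apply]
    rw [trunc, this, TensorProduct.map_zero_left, LinearMap.zero_apply]
  trunc_comm _ _ p ω h := trunc_d h p ω
  trunc_self := trunc_d_self
  trunc_eq i ω := (trunc_eq_self i ω).imp fun p hp => hp p le_rfl

lemma mem_coeffIn_polynomialsLT_sup (m : ℕ) (ω : Multiform n D) :
    ω ∈ coeffIn n (polynomialsLT D m) ⊔ coeffIn n (vanishing D m) := by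
  induction ω using TensorProduct.induction_on with
  | zero => exact zero_mem _
  | add ω η hω hη => exact add_mem hω hη
  | tmul a f =>
    obtain ⟨p, hp, g, hg, rfl⟩ := Submodule.mem_sup.mp (mem_polynomialsLT_sup_vanishing m f)
    rw [TensorProduct.tmul_add]
    exact Submodule.add_mem_sup (tmul_mem_coeffIn a hp) (tmul_mem_coeffIn a hg)

lemma coeffIn_polynomialsLT_le (n D m : ℕ) :
    coeffIn n (polynomialsLT D m) ≤ polynomialMultiforms n D m := by
  refine Submodule.span_mono ?_
  rintro _ ⟨a, f, hf, rfl⟩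
  exact ⟨a, f, .of_mem hf, rfl⟩

/-- Each differential lowers the degree bound by one, and no nonzero polynomial has degree `< 0`. -/
lemma dProd_eq_zero_of_polynomialsLT (I : Finset (Fin n)) {ω : Multiform n D}
    (hω : ω ∈ coeffIn n (polynomialsLT D I.card)) : dProd I ω = 0 := by
  have h := orderedProd_mem (d := d) (M := fun m => coeffIn n (polynomialsLT D m))
    (fun i m _ h => d_mem_coeffIn i (fun μ => partialDeriv_mem_polynomialsLT μ m) h) I (s := 0)
    (by rwa [zero_add])
  rwa [polynomialsLT_zero, coeffIn_bot, Submodule.mem_bot] at h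

end

end Multicomplex

/-! ### The generalized Poincaré lemma -/

theorem theorem2 (N D : ℕ) (K : Finset (Fin (N - 1))) (hK : K.Nonempty) (m : ℕ)
    (hm : m ≤ K.card) (ω : Multicomplex.Multiform (N - 1) D)
    (hω : ∀ I : Finset (Fin (N - 1)), I ⊆ K → I.card = m → Multicomplex.dProd I ω = 0) :
    ∃ (α : Finset (Fin (N - 1)) → Multicomplex.Multiform (N - 1) D)
      (ω₀ : Multicomplex.Multiform (N - 1) D),
      ω₀ ∈ Multicomplex.polynomialMultiforms (N - 1) D m ∧
      ω = (∑ J ∈ K.powersetCard (K.card - m + 1), Multicomplex.dProd J (α J)) + ω₀ := by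
  obtain ⟨ω₀, hω₀, η, hη, rfl⟩ :=
    Submodule.mem_sup.mp (Multicomplex.mem_coeffIn_polynomialsLT_sup m ω)
  have h := (Multicomplex.exactMulticomplex_multiform (N - 1) D).mem_of_orderedProd_mem K ∅ m
    (K.card - m + 1) 0 η (Finset.disjoint_empty_left K) (by omega) hη (by
      intro I hIK hI
      have h1 := hω I hIK hI
      rw [map_add, Multicomplex.dProd_eq_zero_of_polynomialsLT I (hI.symm ▸ hω₀),
        zero_add] at h1
      change Multicomplex.dProd I η ∈ _
      rw [h1]
      exact zero_mem _)
  -- With `S = ∅` the ignored images are zero, so only the products indexed by `J` survive.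
  rw [Multicomplex.boundaries_empty, bot_sup_eq, Submodule.mem_iSup_finset_iff_exists_sum] at h
  obtain ⟨β, hβ⟩ := h
  choose α hα using fun J => (β J).2
  refine ⟨α, ω₀, Multicomplex.coeffIn_polynomialsLT_le _ _ _ hω₀, ?_⟩
  rw [add_comm, ← hβ]
  exact congrArg (· + ω₀) (Finset.sum_congr rfl fun J _ => (hα J).symm)
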